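/- Let $G$ be a directed acyclic graph with nodes $[d]=\{1,\dots,d\}$, with parents $\mathrm{pa}(i)$, ancestors $\mathrm{anc}(i)$ and $\overline{\mathrm{anc}}(i)=\mathrm{anc}(i)\cup\{i\}$, and let $\tau_1,\dots,\tau_K\subseteq[d]$ be intervention targets; $G$ and the $\tau_k$ are known (fixed). A latent causal Bayesian network (CBN) consists of causal mechanisms, i.e. conditional densities $p_i(z_i\mid z_{\mathrm{pa}(i)})$ for $i\in[d]$, of intervened mechanisms, i.e. conditional densities $\tilde p^k_j(z_j\mid z_{\mathrm{pa}^k(j)})$ with $\mathrm{pa}^k(j)\subseteq\mathrm{pa}(j)$ for $k\in[K]$, $j\in\tau_k$, and of a mixing map $f$ on $\mathbb R^d$. Its latent laws $\mathbb P^0,\dots,\mathbb P^K$ on $\mathbb R^d$ have the Lebesgue densities $\prod_i p_i(z_i\mid z_{\mathrm{pa}(i)})$ for $k=0$ and $\prod_{j\in\tau_k}\tilde p^k_j(z_j\mid z_{\mathrm{pa}^k(j)})\prod_{i\notin\tau_k}p_i(z_i\mid z_{\mathrm{pa}(i)})$ for $k\in[K]$. The intervention on $j\in\tau_k$ is perfect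 if $\mathrm{pa}^k(j)=\emptyset$; if $\tau_k=\{i\}$, it satisfies interventional discrepancy if, for Lebesgue-almost every $z$, $\partial_{z_i}\ln p_i(z_i\mid z_{\mathrm{pa}(i)})$ and $\partial_{z_i}\ln\tilde p^k_i(z_i\mid z_{\mathrm{pa}^k(i)})$ exist and are different. Let $\mathcal C$ be a class of such latent CBNs (all with the given $G$ and $\tau_1,\dots,\tau_K$) whose mixing maps are $C^1$-diffeomorphisms of $\mathbb R^d$ and whose laws $\mathbb P^0,\dots,\mathbb P^K$ all have full support in $\mathbb R^d$ and a differentiable density. Call $\mathcal C$ identifiable up to a set $\mathcal S$ of maps $\mathbb R^d\to\mathbb R^d$ if, for any two members of $\mathcal C$ with mixing maps $f,f'$ and latent laws $\mathbb P^k,\mathbb Q^k$, the equalities $f_*\mathbb P^k=f'_*\mathbb Q^k$ for all $k\in\{0,\dots,K\}$ imply that there is $h\in\mathcal S$ with $h=f'^{-1}\circ f$ on the support of $\mathbb P^0$ (which is $\mathbb R^d$). (i) Suppose that for each node $i\in[d]$ there is a regime $k$ with $\tau_k=\{i\}$ such that in every member of $\mathcal C$ the (perfect or imperfect) intervention in regime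 $k$ satisfies interventional discrepancy. Then $\mathcal C$ is identifiable up to $$\mathcal S_{\overline G}=\{h:\mathbb R^d\to\mathbb R^d \text{ a } C^1\text{-diffeomorphism}\mid h(z)=(h_i(z_{\overline{\mathrm{anc}}(i)}))_{i\in[d]}\}.$$ (ii) Suppose that for each node $i\in[d]$ there is a regime $k$ with $\tau_k=\{i\}$ such that in every member of $\mathcal C$ the intervention in regime $k$ is perfect and satisfies interventional discrepancy. Then $\mathcal C$ is identifiable up to $$\mathcal S_{\text{scaling}}=\{h:\mathbb R^d\to\mathbb R^d\mid h(z)=(h_1(z_1),\dots,h_d(z_d)),\ \text{each } h_i \text{ a } C^1\text{-diffeomorphism of } \mathbb R\}.$$ -/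

import Mathlib

open MeasureTheory

noncomputable section

namespace CauCA

/-- `G` is a directed acyclic graph: there is no directed cycle (in particular no loop). -/
def IsDAG {d : ℕ} (G : Digraph (Fin d)) : Prop :=
  ∀ i, ¬ Relation.TransGen G.Adj i i

/-- The parents of the node `i`. -/
def pa {d : ℕ} (G : Digraph (Fin d)) (i : Fin d) : Set (Fin d) :=
  {j | G.Adj j i}

/-- The ancestors of the node `i`: all `j` with a directed path from `j` to `i`. -/
def anc {d : ℕ} (G : Digraph (Fin d)) (i : Fin d) : Set (Fin d) :=
  {j | Relation.TransGen G.Adj j i}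

/-- The closure of the ancestors of the node `i`. -/
def ancBar {d : ℕ} (G : Digraph (Fin d)) (i : Fin d) : Set (Fin d) :=
  insert i (anc G i)

/-- `p` is a conditional probability density of the coordinate `i` given the coordinates in `S`,
written as a function of the whole vector `z`: `p z` is the value `p (z_i | z_S)`. -/
structure IsMechanism {d : ℕ} (i : Fin d) (S : Set (Fin d)) (p : (Fin d → ℝ) → ℝ) : Prop where
  measurable : Measurable p
  nonneg : ∀ z, 0 ≤ p z
  dependsOn : DependsOn p (insert i S)
  lintegral_eq_one : ∀ z, ∫⁻ t : ℝ, ENNReal.ofReal (p (Function.update z i t)) = 1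

/-- The measure with Lebesgue density `∏ i, p_i (z_i | z_{S i})`. -/
def productLaw {d : ℕ} (p : Fin d → (Fin d → ℝ) → ℝ) : Measure (Fin d → ℝ) :=
  volume.withDensity fun z => ENNReal.ofReal (∏ i, p i z)

/-- An absolutely continuous law is Markov relative to `G` if it factorizes into
mechanisms of the coordinates given their parents. -/
def IsMarkov {d : ℕ} (G : Digraph (Fin d)) (P : Measure (Fin d → ℝ)) : Prop :=
  ∃ p : Fin d → (Fin d → ℝ) → ℝ, (∀ i, IsMechanism i (pa G i) (p i)) ∧ P = productLaw p

/-- A causal Bayesian network with graph `G` and interventional regimes `k : Fin K` with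
targets `τ k`. -/
structure CBN {d K : ℕ} (G : Digraph (Fin d)) (τ : Fin K → Finset (Fin d)) where
  /-- the causal mechanisms -/
  mech : Fin d → (Fin d → ℝ) → ℝ
  isMechanism_mech : ∀ i, IsMechanism i (pa G i) (mech i)
  /-- the parents of the targets in the post-intervention graphs -/
  postPa : Fin K → Fin d → Set (Fin d)
  postPa_subset : ∀ k, ∀ j ∈ τ k, postPa k j ⊆ pa G j
  /-- the intervened mechanisms (only the values at `j ∈ τ k` matter) -/
  intMech : Fin K → Fin d → (Fin d → ℝ) → ℝ
  isMechanism_intMech : ∀ k, ∀ j ∈ τ k, IsMechanism j (postPa k j) (intMech k j)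

/-- The mechanism of node `i` in a regime: `none` is the unintervened regime, `some k` is the
interventional regime `k`. -/
def CBN.regimeMech {d K : ℕ} {G : Digraph (Fin d)} {τ : Fin K → Finset (Fin d)}
    (C : CBN G τ) : Option (Fin K) → Fin d → (Fin d → ℝ) → ℝ
  | none, i => C.mech i
  | some k, i => if i ∈ τ k then C.intMech k i else C.mech i

/-- The joint law of the latent variables in a regime. -/
def CBN.law {d K : ℕ} {G : Digraph (Fin d)} {τ : Fin K → Finset (Fin d)}
    (C : CBN G τ) (k : Option (Fin K)) : Measure (Fin d → ℝ) :=
  productLaw (C.regimeMech k)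

/-- The intervention on node `i` in regime `k` is perfect: it removes all arrows into `i`. -/
def CBN.IsPerfect {d K : ℕ} {G : Digraph (Fin d)} {τ : Fin K → Finset (Fin d)}
    (C : CBN G τ) (k : Fin K) (i : Fin d) : Prop :=
  C.postPa k i = ∅

/-- Interventional discrepancy of the intervention on node `i` in regime `k`: for Lebesgue-almost
every `z`, the logarithms of the causal and of the intervened mechanism are defined and have
partial derivatives with respect to `z_i` at `z`, and these are different. -/
def CBN.InterventionalDiscrepancy {d K : ℕ} {G : Digraph (Fin d)} {τ : Fin K → Finset (Fin d)}
    (C : CBN G τ) (k : Fin K) (i : Fin d) : Prop :=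
  ∀ᵐ z : Fin d → ℝ, 0 < C.mech i z ∧ 0 < C.intMech k i z ∧
    ∃ a b : ℝ,
      HasDerivAt (fun t : ℝ => Real.log (C.mech i (Function.update z i t))) a (z i) ∧
      HasDerivAt (fun t : ℝ => Real.log (C.intMech k i (Function.update z i t))) b (z i) ∧
      a ≠ b

/-- A latent CBN: a CBN together with a diffeomorphism `mix` of `ℝ^d`, the mixing function. -/
structure LatentCBN {d K : ℕ} (G : Digraph (Fin d)) (τ : Fin K → Finset (Fin d))
    extends CBN G τ where
  mix : (Fin d → ℝ) ≃ (Fin d → ℝ)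
  differentiable_mix : Differentiable ℝ mix
  differentiable_mix_symm : Differentiable ℝ mix.symm

/-- The latent CBNs with graph `G` and targets `τ` that are in the model class `(G, F, P)`. -/
def modelClass {d K : ℕ} (G : Digraph (Fin d)) (τ : Fin K → Finset (Fin d))
    (F : Set ((Fin d → ℝ) ≃ (Fin d → ℝ))) (P : Set (Measure (Fin d → ℝ))) :
    Set (LatentCBN G τ) :=
  {M | M.mix ∈ F ∧ ∀ k, M.law k ∈ P}

/-- The class of all `C¹`-diffeomorphisms of `ℝ^d`. -/
def c1Diffeos (d : ℕ) : Set ((Fin d → ℝ) ≃ (Fin d → ℝ)) :=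
  {f | ContDiff ℝ 1 f ∧ ContDiff ℝ 1 f.symm}

/-- The class of all probability laws that are Markov relative to `G`, are absolutely continuous
with a differentiable density, and have full support in `ℝ^d`. -/
def latentLaws {d : ℕ} (G : Digraph (Fin d)) : Set (Measure (Fin d → ℝ)) :=
  {P | IsProbabilityMeasure P ∧ IsMarkov G P ∧ P.support = Set.univ ∧
    ∃ p : (Fin d → ℝ) → ℝ, (∀ z, 0 ≤ p z) ∧ Differentiable ℝ p ∧
      P = volume.withDensity fun z => ENNReal.ofReal (p z)}

/-- Identifiability of a class `𝓒` of latent CBNs with the same graph and the same targets up to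
an indeterminacy set `S`: whenever two members have the same observed laws in all regimes, then
`f'⁻¹ ∘ f` agrees with some `h ∈ S` on the support of the latent law. -/
def IsIdentifiable {d K : ℕ} {G : Digraph (Fin d)} {τ : Fin K → Finset (Fin d)}
    (𝓒 : Set (LatentCBN G τ)) (S : Set ((Fin d → ℝ) → (Fin d → ℝ))) : Prop :=
  ∀ M ∈ 𝓒, ∀ M' ∈ 𝓒,
    (∀ k : Option (Fin K), (M.law k).map M.mix = (M'.law k).map M'.mix) →
      ∃ h ∈ S, Set.EqOn h (M'.mix.symm ∘ M.mix) (M.law none).support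

/-- The `C¹`-diffeomorphisms `h` of `ℝ^d` such that `h_i` depends only on the coordinates in
the closure of the ancestors of `i`. -/
def ancestralMaps {d : ℕ} (G : Digraph (Fin d)) : Set ((Fin d → ℝ) → (Fin d → ℝ)) :=
  {h | (∃ e ∈ c1Diffeos d, h = e) ∧ ∀ i, DependsOn (fun z => h z i) (ancBar G i)}

/-- The maps `z ↦ (h_1(z_1), …, h_d(z_d))` with all `h_i` being (`C¹`-)diffeomorphisms of `ℝ`. -/
def scalingMaps (d : ℕ) : Set ((Fin d → ℝ) → (Fin d → ℝ)) :=
  {h | ∃ e : Fin d → (ℝ ≃ ℝ), (∀ i, ContDiff ℝ 1 (e i) ∧ ContDiff ℝ 1 (e i).symm) ∧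
    h = fun z i => e i (z i)}

end CauCA

end

namespace CauCA

/-! Put `h = f'⁻¹ ∘ f`; it carries each latent law of the first model to that of the second, so the
densities satisfy `p = |det Dh| · (q ∘ h)`. In the log ratio of regime `k`, with target `{i}`, to
the unintervened regime, the Jacobian and all mechanisms other than that of `i` cancel. This leaves
`L = L' ∘ h` a.e., where `L` and `L'` vary only along `i` and its parents.

(i) Differentiate along `l ∉ ancBar G i`. By induction over ancestors the parents of `i` contribute
nothing, so `∂_i L' (h z) · ∂_l h_i (z) = 0`. Discrepancy makes the first factor nonzero a.e., and
continuity of `Dh` gives `∂_l h_i = 0` everywhere (`fderiv_single_eq_zero_of_ae_eq_comp`,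
`dependsOn_ancBar_of_map_eq`).

(ii) Under a perfect intervention, coordinate `i` is independent of its ancestors in both models. As
`h` and `h⁻¹` respect ancestors, almost every fibre map `t ↦ h_i (z with z_i = t)` carries one fixed
law to another (`ae_rootLaw_preimage_eq`). These maps all induce the same order on the line, so full
support forces them to coincide (`eq_of_measure_le_eq`), and `h_i` depends on `z_i` alone. -/

open Filter Topology

/-! ### Partial derivatives of functions known almost everywhere -/

/-- Two functions on the line that agree almost everywhere have the same derivative wherever
both are differentiable. -/
theorem hasDerivAt_unique_of_ae_eq {f g : ℝ → ℝ} {a b x : ℝ} (hf : HasDerivAt f a x)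
    (hg : HasDerivAt g b x) (h : f =ᵐ[volume] g) : a = b := by
  by_contra hab
  -- A nonzero derivative excludes zeros of `f - g` in a punctured neighbourhood of `x`, whereas
  -- zeros are dense because they have full measure.
  have h1 := (hf.sub hg).eventually_ne (c := 0) (sub_ne_zero.2 hab)
  have h2 : ∃ᶠ t in 𝓝[≠] x, (f - g) t = 0 := by
    have hd : Dense ({t | f t = g t} \ {x}) := by
      apply Measure.dense_of_ae (μ := volume)
      filter_upwards [h, compl_mem_ae_iff.2 (measure_singleton x)] with t ht hx using ⟨ht, hx⟩
    rw [frequently_iff]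
    intro U hU
    obtain ⟨V, hV, hxV, hVU⟩ := mem_nhdsWithin.1 hU
    obtain ⟨y, hyV, hy⟩ := hd.inter_open_nonempty V hV ⟨x, hxV⟩
    exact ⟨y, hVU ⟨hyV, hy.2⟩, sub_eq_zero.2 hy.1⟩
  exact h2 h1

variable {d : ℕ}

/-- A property that holds almost everywhere holds almost everywhere on almost every line in a
given direction. -/
theorem ae_ae_add_smul {E : Type*} [NormedAddCommGroup E] [NormedSpace ℝ E]
    [FiniteDimensional ℝ E] [MeasurableSpace E] [BorelSpace E] (μ : Measure E)
    [μ.IsAddHaarMeasure] {Q : E → Prop} (hQ : ∀ᵐ z ∂μ, Q z) (v : E) :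
    ∀ᵐ z ∂μ, ∀ᵐ s : ℝ, Q (z + s • v) := by
  have := FiniteDimensional.proper ℝ E
  obtain ⟨N, hN, hNm, hN0⟩ := exists_measurable_superset_of_null hQ
  -- For fixed `s` the translation preserves `μ`; Fubini then exchanges the quantifiers, which is
  -- why `N` must be measurable.
  have h1 : ∀ᵐ s : ℝ, ∀ᵐ z ∂μ, z + s • v ∈ Nᶜ := by
    refine Eventually.of_forall fun s => ?_
    exact (measurePreserving_add_right μ (s • v)).quasiMeasurePreserving.ae
      (p := fun z => z ∈ Nᶜ) (compl_mem_ae_iff.2 hN0)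
  have hcont : Continuous fun x : ℝ × E => x.2 + x.1 • v := by fun_prop
  have hms : MeasurableSet {x : ℝ × E | x.2 + x.1 • v ∈ Nᶜ} :=
    hcont.measurable hNm.compl
  filter_upwards [(Measure.ae_ae_comm (p := fun s z => z + s • v ∈ Nᶜ) hms).1 h1] with z hz
  filter_upwards [hz] with s hs
  by_contra hc
  exact hs (hN hc)

/-- A property that holds almost everywhere holds almost everywhere on almost every line in a
coordinate direction. -/
theorem ae_ae_update {Q : (Fin d → ℝ) → Prop} (hQ : ∀ᵐ z, Q z) (i : Fin d) :
    ∀ᵐ z : Fin d → ℝ, ∀ᵐ t : ℝ, Q (Function.update z i t) := by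
  filter_upwards [ae_ae_add_smul volume hQ (Pi.single i (1 : ℝ))] with z hz
  have h2 := (measurePreserving_sub_right volume (z i)).quasiMeasurePreserving.ae hz
  filter_upwards [h2] with t ht
  have h3 : z + (t - z i) • Pi.single i (1 : ℝ) = Function.update z i t := by
    ext j
    by_cases hj : j = i
    · subst hj; simp
    · simp [hj]
  rwa [h3] at ht

/-- If `L` is differentiable almost everywhere and agrees almost everywhere with `l`, then the
partial derivatives of `L` agree almost everywhere with those of `l`, wherever these exist. -/
theorem ae_fderiv_single_eq {L l : (Fin d → ℝ) → ℝ} (hL : ∀ᵐ z, DifferentiableAt ℝ L z)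
    (h : L =ᵐ[volume] l) (i : Fin d) :
    ∀ᵐ z : Fin d → ℝ, ∀ b, HasDerivAt (fun t => l (Function.update z i t)) b (z i) →
      fderiv ℝ L z (Pi.single i 1) = b := by
  filter_upwards [hL, ae_ae_update h i] with z hz hz' b hb
  have h1 : HasFDerivAt L (fderiv ℝ L z) (Function.update z i (z i)) := by
    rw [Function.update_eq_self]; exact hz.hasFDerivAt
  exact hasDerivAt_unique_of_ae_eq (h1.comp_hasDerivAt (z i) (hasDerivAt_update z i (z i))) hb hz'

/-- A differentiable function whose partial derivatives outside `S` vanish depends only on the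
coordinates in `S`. -/
theorem dependsOn_of_fderiv_single_eq_zero {f : (Fin d → ℝ) → ℝ} (hf : Differentiable ℝ f)
    {S : Set (Fin d)} (h : ∀ l ∉ S, ∀ z, fderiv ℝ f z (Pi.single l 1) = 0) : DependsOn f S := by
  intro x y hxy
  -- Along the segment from `x` to `y` the direction `y - x` vanishes on `S`, so only the partials
  -- outside `S` enter.
  have hderiv : ∀ s : ℝ, HasDerivAt (fun s : ℝ => f (x + s • (y - x))) 0 s := by
    intro s
    have h1 : HasDerivAt (fun s : ℝ => x + s • (y - x)) (y - x) s := by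
      simpa using ((hasDerivAt_id s).smul_const (y - x)).const_add x
    have h2 := (hf (x + s • (y - x))).hasFDerivAt.comp_hasDerivAt s h1
    have h3 : fderiv ℝ f (x + s • (y - x)) (y - x) = 0 := by
      refine (LinearMap.pi_apply_eq_sum_univ
        (fderiv ℝ f (x + s • (y - x))).toLinearMap (y - x)).trans ?_
      refine Finset.sum_eq_zero fun l _ => ?_
      by_cases hl : l ∈ S
      · simp [hxy l hl]
      · have := h l hl (x + s • (y - x))
        have e : (fun j => if l = j then (1 : ℝ) else 0) = Pi.single l 1 := by
          ext j; simp [Pi.single_apply, eq_comm]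
        simp only [ContinuousLinearMap.coe_coe, e, this, smul_zero]
    rwa [h3] at h2
  have := is_const_of_deriv_eq_zero (fun s => (hderiv s).differentiableAt)
    (fun s => (hderiv s).deriv) 0 1
  simpa using this

/-! ### Change of variables and the chain rule for log ratios -/

/-- Change of variables for the densities of two laws related by a diffeomorphism. -/
theorem ae_density_eq_of_map_eq {h : (Fin d → ℝ) ≃ (Fin d → ℝ)} (hh : Differentiable ℝ h)
    (hh' : Differentiable ℝ h.symm) {p q : (Fin d → ℝ) → ℝ} (hp : Measurable p)
    (hq : Measurable q) (hp0 : ∀ z, 0 ≤ p z) (hq0 : ∀ z, 0 ≤ q z)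
    (hmap : (volume.withDensity fun z => ENNReal.ofReal (p z)).map h =
      volume.withDensity fun z => ENNReal.ofReal (q z)) :
    ∀ᵐ z, p z = |(fderiv ℝ h z).det| * q (h z) := by
  have hm : Measurable h := hh.continuous.measurable
  have hm' : Measurable h.symm := hh'.continuous.measurable
  have hdet : Measurable fun z => |(fderiv ℝ h z).det| :=
    (ContinuousLinearMap.continuous_det.measurable.comp (measurable_fderiv ℝ h)).abs
  have key : (volume.withDensity fun z => ENNReal.ofReal (p z)) =
      volume.withDensity fun z =>
        ENNReal.ofReal |(fderiv ℝ h z).det| * ENNReal.ofReal (q (h z)) := by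
    ext A hA
    have hA' : MeasurableSet (h '' A) := by
      rw [h.image_eq_preimage_symm]; exact hm' hA
    -- Testing the push-forward identity on `h '' A`, whose preimage is `A`, reduces it to the
    -- Jacobian formula for integrals over images.
    have h1 := congrArg (fun μ => μ (h '' A)) hmap
    simp only [Measure.map_apply hm hA', Set.preimage_image_eq _ h.injective] at h1
    rw [h1, withDensity_apply _ hA', withDensity_apply _ hA,
      lintegral_image_eq_lintegral_abs_det_fderiv_mul volume hA
        (fun x _ => (hh x).hasFDerivAt.hasFDerivWithinAt) h.injective.injOn]
  have hm2 : Measurable fun z => ENNReal.ofReal |(fderiv ℝ h z).det| * ENNReal.ofReal (q (h z)) :=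
    hdet.ennreal_ofReal.mul (hq.comp hm).ennreal_ofReal
  filter_upwards [(withDensity_eq_iff_of_sigmaFinite hp.ennreal_ofReal.aemeasurable
    hm2.aemeasurable).1 key] with z hz
  rw [← ENNReal.ofReal_mul (abs_nonneg _)] at hz
  exact (ENNReal.ofReal_eq_ofReal_iff (hp0 z) (mul_nonneg (abs_nonneg _) (hq0 _))).1 hz

/-- A bijection with differentiable inverse pulls back null sets to null sets. -/
theorem ae_comp_of_differentiable_symm {h : (Fin d → ℝ) ≃ (Fin d → ℝ)}
    (hh' : Differentiable ℝ h.symm) {Q : (Fin d → ℝ) → Prop} (hQ : ∀ᵐ z, Q z) :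
    ∀ᵐ z, Q (h z) := by
  have h1 := addHaar_image_eq_zero_of_differentiableOn_of_addHaar_eq_zero volume
    (s := {z | ¬ Q z}) hh'.differentiableOn (ae_iff.1 hQ)
  rw [h.symm.image_eq_preimage_symm] at h1
  exact ae_iff.2 h1

/-- If `L = L' ∘ h`, the function `L` does not vary in the direction `l`, the function `L'` varies
in the direction `i` and otherwise only in directions `j ∈ S` for which `h j` does not vary in
the direction `l`, then `h i` does not vary in the direction `l` either. -/
theorem fderiv_single_eq_zero_of_ae_eq_comp {h : (Fin d → ℝ) ≃ (Fin d → ℝ)}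
    (hh : ContDiff ℝ 1 h) (hh' : ContDiff ℝ 1 h.symm) {L L' : (Fin d → ℝ) → ℝ}
    (hL : ∀ᵐ z, DifferentiableAt ℝ L z) (hL' : ∀ᵐ z, DifferentiableAt ℝ L' z)
    (hLL' : L =ᵐ[volume] L' ∘ h) {i l : Fin d} {S : Set (Fin d)}
    (hl : ∀ᵐ z, fderiv ℝ L z (Pi.single l 1) = 0)
    (hS : ∀ j ∉ insert i S, ∀ᵐ z, fderiv ℝ L' z (Pi.single j 1) = 0)
    (hi : ∀ᵐ z, fderiv ℝ L' z (Pi.single i 1) ≠ 0)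
    (hSl : ∀ j ∈ S, ∀ z, fderiv ℝ (fun z => h z j) z (Pi.single l 1) = 0) :
    ∀ z, fderiv ℝ (fun z => h z i) z (Pi.single l 1) = 0 := by
  have hd := hh.differentiable one_ne_zero
  have hd' := hh'.differentiable one_ne_zero
  have hcoord : ∀ j z v, fderiv ℝ (fun z => h z j) z v = fderiv ℝ h z v j := by
    intro j z v
    rw [((hasFDerivAt_pi'.1 (hd z).hasFDerivAt) j).fderiv]
    simp
  have hS' : ∀ᵐ w, ∀ j, j ∉ insert i S → fderiv ℝ L' w (Pi.single j 1) = 0 := by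
    rw [ae_all_iff]
    intro j
    by_cases hj : j ∈ insert i S
    · simp [hj]
    · filter_upwards [hS j hj] with w hw _ using hw
  have hae : ∀ᵐ z, fderiv ℝ h z (Pi.single l 1) i = 0 := by
    filter_upwards [hl, ae_fderiv_single_eq hL hLL' l, ae_comp_of_differentiable_symm hd' hL',
      ae_comp_of_differentiable_symm hd' hS', ae_comp_of_differentiable_symm hd' hi]
      with z hzl hz hzL' hzS hzi
    set c := fderiv ℝ h z (Pi.single l 1) with hc
    have h1 : HasFDerivAt h (fderiv ℝ h z) (Function.update z l (z l)) := by
      rw [Function.update_eq_self]; exact (hd z).hasFDerivAt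
    have h2 := h1.comp_hasDerivAt (z l) (hasDerivAt_update z l (z l))
    have h3 : HasFDerivAt L' (fderiv ℝ L' (h z)) ((h ∘ Function.update z l) (z l)) := by
      simp only [Function.comp_apply, Function.update_eq_self]; exact hzL'.hasFDerivAt
    -- `L` and `L' ∘ h` agree only a.e., so their partial derivatives at `z` are identified through
    -- `hz`, not by rewriting.
    have h4 := hz _ (h3.comp_hasDerivAt (z l) h2)
    rw [hzl, ← hc] at h4
    have h5 : fderiv ℝ L' (h z) c = c i * fderiv ℝ L' (h z) (Pi.single i 1) := by
      refine (LinearMap.pi_apply_eq_sum_univ (fderiv ℝ L' (h z)).toLinearMap c).trans ?_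
      have e : ∀ l : Fin d, (fun j => if l = j then (1 : ℝ) else 0) = Pi.single l 1 := by
        intro l; ext j; simp [Pi.single_apply, eq_comm]
      simp only [ContinuousLinearMap.coe_coe, e, smul_eq_mul]
      refine Finset.sum_eq_single i (fun j _ hj => ?_) (by simp)
      by_cases hjS : j ∈ S
      · have := hSl j hjS z
        rw [hcoord] at this
        rw [hc, this, zero_mul]
      · rw [hzS j (by simp [hj, hjS]), mul_zero]
    rw [h5] at h4
    exact (mul_eq_zero.1 h4.symm).resolve_right hzi
  -- Here `C¹` is needed rather than differentiability: a continuous function vanishing a.e.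
  -- vanishes everywhere.
  have hcont : Continuous fun z => fderiv ℝ h z (Pi.single l 1) i :=
    (continuous_apply i).comp ((hh.continuous_fderiv one_ne_zero).clm_apply continuous_const)
  have := (hcont.ae_eq_iff_eq volume continuous_const).1 hae
  intro z
  rw [hcoord]
  exact congrFun this z

/-! ### Log density ratios of a causal Bayesian network -/

variable {K : ℕ} {G : Digraph (Fin d)} {τ : Fin K → Finset (Fin d)}

/-- Interventions only remove parents, so every regime still factorizes along the original `G`, and
the lemmas on `productLaw` apply to all regimes alike. -/
theorem CBN.isMechanism_regimeMech (C : CBN G τ) (k : Option (Fin K)) (i : Fin d) :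
    IsMechanism i (pa G i) (C.regimeMech k i) := by
  cases k with
  | none => exact C.isMechanism_mech i
  | some k =>
    by_cases hi : i ∈ τ k
    · have := C.isMechanism_intMech k i hi
      simp only [CBN.regimeMech, if_pos hi]
      exact ⟨this.measurable, this.nonneg,
        this.dependsOn.mono (Set.insert_subset_insert (C.postPa_subset k i hi)),
        this.lintegral_eq_one⟩
    · simp only [CBN.regimeMech, if_neg hi]
      exact C.isMechanism_mech i

/-- A density of the law in some regime is almost everywhere the product of the mechanisms. -/
theorem CBN.ae_density_eq (C : CBN G τ) (k : Option (Fin K)) {p : (Fin d → ℝ) → ℝ}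
    (hp : Measurable p) (hp0 : ∀ z, 0 ≤ p z)
    (h : C.law k = volume.withDensity fun z => ENNReal.ofReal (p z)) :
    ∀ᵐ z, p z = ∏ i, C.regimeMech k i z := by
  have hm : Measurable fun z => ∏ i, C.regimeMech k i z :=
    Finset.measurable_prod _ fun i _ => (C.isMechanism_regimeMech k i).measurable
  filter_upwards [(withDensity_eq_iff_of_sigmaFinite hp.ennreal_ofReal.aemeasurable
    hm.ennreal_ofReal.aemeasurable).1 h.symm] with z hz
  exact (ENNReal.ofReal_eq_ofReal_iff (hp0 z)
    (Finset.prod_nonneg fun i _ => (C.isMechanism_regimeMech k i).nonneg z)).1 hz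

/-- The logarithmic density ratio of an interventional law to the unintervened law, for an
intervention on the single node `i`, varies only in the directions of `i` and its parents, and
it does vary in the direction of `i`. -/
theorem CBN.exists_densities (C : CBN G τ) (hC : ∀ k, C.law k ∈ latentLaws G)
    (hpos : ∀ᵐ z, ∀ j, 0 < C.mech j z) {k : Fin K} {i : Fin d} (hk : τ k = {i})
    (hD : C.InterventionalDiscrepancy k i) :
    ∃ p q : (Fin d → ℝ) → ℝ, Measurable p ∧ Measurable q ∧ (∀ z, 0 ≤ p z) ∧ (∀ z, 0 ≤ q z) ∧
      (∀ᵐ z, 0 < p z) ∧ (∀ᵐ z, 0 < q z) ∧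
      C.law none = (volume.withDensity fun z => ENNReal.ofReal (p z)) ∧
      C.law (some k) = (volume.withDensity fun z => ENNReal.ofReal (q z)) ∧
      (∀ᵐ z, DifferentiableAt ℝ (fun z => Real.log (q z) - Real.log (p z)) z) ∧
      (∀ j ∉ insert i (pa G i), ∀ᵐ z,
        fderiv ℝ (fun z => Real.log (q z) - Real.log (p z)) z (Pi.single j 1) = 0) ∧
      ∀ᵐ z, fderiv ℝ (fun z => Real.log (q z) - Real.log (p z)) z (Pi.single i 1) ≠ 0 := by
  -- The mechanisms are only known to be measurable; `p` and `q` are differentiable densities that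
  -- agree a.e. with the products of mechanisms.
  obtain ⟨-, -, -, p, hp0, hpd, hp⟩ := hC none
  obtain ⟨-, -, -, q, hq0, hqd, hq⟩ := hC (some k)
  have hpm := hpd.continuous.measurable
  have hqm := hqd.continuous.measurable
  have hpae := C.ae_density_eq none hpm hp0 hp
  have hqae := C.ae_density_eq (some k) hqm hq0 hq
  have hregi : C.regimeMech (some k) i = C.intMech k i := by simp [CBN.regimeMech, hk]
  have hreg : ∀ j ≠ i, C.regimeMech (some k) j = C.mech j := by
    intro j hj; simp [CBN.regimeMech, hk, hj]
  have hprod : ∀ z, ∏ j, C.regimeMech (some k) j z =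
      C.intMech k i z * ∏ j ∈ Finset.univ.erase i, C.mech j z := by
    intro z
    rw [← Finset.mul_prod_erase _ _ (Finset.mem_univ i), hregi]
    congr 1
    exact Finset.prod_congr rfl fun j hj => by rw [hreg j (Finset.ne_of_mem_erase hj)]
  have hprod0 : ∀ z, ∏ j, C.regimeMech none j z =
      C.mech i z * ∏ j ∈ Finset.univ.erase i, C.mech j z := fun z =>
    (Finset.mul_prod_erase _ _ (Finset.mem_univ i)).symm
  have hppos : ∀ᵐ z, 0 < p z := by
    filter_upwards [hpae, hpos] with z hz hz'
    rw [hz]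
    exact Finset.prod_pos fun j _ => hz' j
  have hqpos : ∀ᵐ z, 0 < q z := by
    filter_upwards [hqae, hpos, hD] with z hz hz' hzD
    rw [hz, hprod]
    exact mul_pos hzD.2.1 (Finset.prod_pos fun j _ => hz' j)
  have hdiff : ∀ᵐ z, DifferentiableAt ℝ (fun z => Real.log (q z) - Real.log (p z)) z := by
    filter_upwards [hppos, hqpos] with z hzp hzq
    exact ((hqd z).log hzq.ne').sub ((hpd z).log hzp.ne')
  -- The mechanisms of the nodes other than `i` are shared by both regimes and cancel.
  have hL : (fun z => Real.log (q z) - Real.log (p z)) =ᵐ[volume]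
      fun z => Real.log (C.intMech k i z) - Real.log (C.mech i z) := by
    filter_upwards [hpae, hqae, hpos, hD] with z hzp hzq hz hzD
    have h1 : ∏ j ∈ Finset.univ.erase i, C.mech j z ≠ 0 :=
      (Finset.prod_pos fun j _ => hz j).ne'
    rw [hzp, hzq, hprod, hprod0, Real.log_mul hzD.2.1.ne' h1, Real.log_mul hzD.1.ne' h1]
    ring
  refine ⟨p, q, hpm, hqm, hp0, hq0, hppos, hqpos, hp, hq, hdiff, fun j hj => ?_, ?_⟩
  · filter_upwards [ae_fderiv_single_eq hdiff hL j] with z hz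
    apply hz
    have e : ∀ t, ∀ a ∈ insert i (pa G i), Function.update z j t a = z a := by
      intro t a ha
      exact Function.update_of_ne (fun h : a = j => hj (h ▸ ha)) _ _
    have h1 : ∀ t, C.mech i (Function.update z j t) = C.mech i z := fun t =>
      (C.isMechanism_mech i).dependsOn (e t)
    have h2 : ∀ t, C.intMech k i (Function.update z j t) = C.intMech k i z := fun t => by
      rw [← hregi]
      exact (C.isMechanism_regimeMech (some k) i).dependsOn (e t)
    simp only [h1, h2]
    exact hasDerivAt_const _ _
  · filter_upwards [ae_fderiv_single_eq hdiff hL i, hD] with z hz hzD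
    obtain ⟨-, -, a, b, ha, hb, hab⟩ := hzD
    rw [hz _ (hb.sub ha)]
    exact sub_ne_zero.2 hab.symm

/-! ### Ancestors, and part (i) -/

theorem pa_subset_anc (G : Digraph (Fin d)) (i : Fin d) : pa G i ⊆ anc G i :=
  fun _ hj => Relation.TransGen.single hj

theorem ancBar_subset_anc {i j : Fin d} (hj : j ∈ anc G i) : ancBar G j ⊆ anc G i := by
  rintro l (rfl | hl)
  · exact hj
  · exact Relation.TransGen.trans hl hj

theorem notMem_anc_self (hG : IsDAG G) (i : Fin d) : i ∉ anc G i := hG i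

theorem IsDAG.wellFounded (hG : IsDAG G) : WellFounded (Relation.TransGen G.Adj) :=
  haveI : Std.Irrefl (Relation.TransGen G.Adj) := ⟨hG⟩
  Finite.wellFounded_of_trans_of_irrefl _

/-- For the reversed order, minimal elements of a set of nodes are its sinks, which can be
integrated out first. -/
theorem IsDAG.wellFounded_swap (hG : IsDAG G) :
    WellFounded (fun i j => Relation.TransGen G.Adj j i) :=
  haveI : Std.Irrefl (fun i j => Relation.TransGen G.Adj j i) := ⟨hG⟩
  haveI : IsTrans (Fin d) (fun i j => Relation.TransGen G.Adj j i) :=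
    ⟨fun _ _ _ hab hbc => hbc.trans hab⟩
  Finite.wellFounded_of_trans_of_irrefl _

theorem map_trans_symm {M M' : LatentCBN G τ} {k : Option (Fin K)}
    (h : (M.law k).map M.mix = (M'.law k).map M'.mix) :
    (M.law k).map (M.mix.trans M'.mix.symm) = M'.law k := by
  have h1 := M.differentiable_mix.continuous.measurable
  have h2 := M'.differentiable_mix.continuous.measurable
  have h3 := M'.differentiable_mix_symm.continuous.measurable
  rw [Equiv.coe_trans, ← Measure.map_map h3 h1, h, Measure.map_map h3 h2]
  simp

theorem c1Diffeos_trans_symm {f f' : (Fin d → ℝ) ≃ (Fin d → ℝ)} (hf : f ∈ c1Diffeos d)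
    (hf' : f' ∈ c1Diffeos d) : f.trans f'.symm ∈ c1Diffeos d :=
  ⟨hf'.2.comp hf.1, hf.2.comp hf'.1⟩

/-- A change of representation between two latent CBNs with the same observed laws respects the
ancestors of each node. -/
theorem dependsOn_ancBar_of_map_eq (hG : IsDAG G) {M M' : LatentCBN G τ}
    (hM : M ∈ modelClass G τ (c1Diffeos d) (latentLaws G))
    (hM' : M' ∈ modelClass G τ (c1Diffeos d) (latentLaws G))
    (hD : ∀ i, ∃ k, τ k = {i} ∧ M.InterventionalDiscrepancy k i ∧
      M'.InterventionalDiscrepancy k i)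
    (hmap : ∀ k, (M.law k).map M.mix = (M'.law k).map M'.mix) (i : Fin d) :
    DependsOn (fun z => M.mix.trans M'.mix.symm z i) (ancBar G i) := by
  -- Every node is the target of some regime, and discrepancy there includes positivity of its
  -- mechanism.
  have hpos : ∀ᵐ z, ∀ j, 0 < M.mech j z := by
    refine ae_all_iff.2 fun j => ?_
    obtain ⟨k, -, h, -⟩ := hD j
    filter_upwards [h] with z hz using hz.1
  have hpos' : ∀ᵐ z, ∀ j, 0 < M'.mech j z := by
    refine ae_all_iff.2 fun j => ?_
    obtain ⟨k, -, -, h⟩ := hD j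
    filter_upwards [h] with z hz using hz.1
  obtain ⟨hh, hh'⟩ := c1Diffeos_trans_symm hM.1 hM'.1
  have hd := hh.differentiable one_ne_zero
  have hd' := hh'.differentiable one_ne_zero
  have hmap' := fun k => map_trans_symm (hmap k)
  set h := M.mix.trans M'.mix.symm
  have main : ∀ i, ∀ l ∉ ancBar G i, ∀ z,
      fderiv ℝ (fun z => h z i) z (Pi.single l 1) = 0 := by
    intro i
    induction i using hG.wellFounded.induction with
    | _ i ih =>
    intro l hl
    obtain ⟨k, hk, hDk, hDk'⟩ := hD i
    obtain ⟨p, q, hp, hq, hp0, hq0, hppos, hqpos, hlp, hlq, hdiff, hS, -⟩ :=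
      M.exists_densities hM.2 hpos hk hDk
    obtain ⟨p', q', hp', hq', hp0', hq0', hppos', hqpos', hlp', hlq', hdiff', hS', hi'⟩ :=
      M'.exists_densities hM'.2 hpos' hk hDk'
    have h1 := hmap' none
    rw [hlp, hlp'] at h1
    have h2 := hmap' (some k)
    rw [hlq, hlq'] at h2
    -- Both densities carry the same Jacobian factor, nonzero wherever `p` is positive, so it
    -- cancels in the log ratio.
    have hcomp : (fun z => Real.log (q z) - Real.log (p z)) =ᵐ[volume]
        (fun z => Real.log (q' z) - Real.log (p' z)) ∘ h := by
      filter_upwards [ae_density_eq_of_map_eq hd hd' hp hp' hp0 hp0' h1,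
        ae_density_eq_of_map_eq hd hd' hq hq' hq0 hq0' h2, hppos, hqpos,
        ae_comp_of_differentiable_symm hd' hppos', ae_comp_of_differentiable_symm hd' hqpos']
        with z hz1 hz2 hz3 hz4 hz5 hz6
      have hdet : |(fderiv ℝ h z).det| ≠ 0 := by
        intro h0
        rw [h0, zero_mul] at hz1
        exact hz3.ne' hz1
      rw [hz1, hz2, Real.log_mul hdet hz5.ne', Real.log_mul hdet hz6.ne', Function.comp_apply]
      ring
    have hsub : insert i (pa G i) ⊆ ancBar G i :=
      Set.insert_subset_insert (pa_subset_anc G i)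
    refine fderiv_single_eq_zero_of_ae_eq_comp hh hh' hdiff hdiff' hcomp
      (hS l fun h => hl (hsub h)) hS' hi' fun j hj => ?_
    have hja := pa_subset_anc G i hj
    exact ih j hja l fun h => hl (Set.mem_insert_of_mem _ (ancBar_subset_anc hja h))
  exact dependsOn_of_fderiv_single_eq_zero (differentiable_pi.1 hd i) (main i)

/-! ### Marginals of Markov factorizations -/

/-- A factor that does not depend on the integrated coordinates can be pulled out of a marginal
integral. -/
theorem lmarginal_mul_of_dependsOn {s : Finset (Fin d)} {t : Set (Fin d)}
    {a b : (Fin d → ℝ) → ENNReal} (ha : DependsOn a t) (hst : ∀ j ∈ t, j ∉ s)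
    (hb : Measurable b) (x : Fin d → ℝ) :
    (∫⋯∫⁻_s, fun z => a z * b z ∂fun _ => volume) x =
      a x * (∫⋯∫⁻_s, b ∂fun _ => volume) x := by
  simp only [lmarginal]
  have hb' : Measurable fun y => b (Function.updateFinset x s y) :=
    hb.comp measurable_updateFinset
  rw [← lintegral_const_mul _ hb']
  refine lintegral_congr fun y => ?_
  congr 1
  exact ha fun j hj => by simp [Function.updateFinset, hst j hj]

/-- Integrating a product of mechanisms over their coordinates gives one. -/
theorem lmarginal_prod_mechanism (hG : IsDAG G) {p : Fin d → (Fin d → ℝ) → ℝ}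
    (hp : ∀ j, IsMechanism j (pa G j) (p j)) (s : Finset (Fin d)) :
    (∫⋯∫⁻_s, fun z => ∏ j ∈ s, ENNReal.ofReal (p j z) ∂fun _ => volume) = fun _ => 1 := by
  induction s using Finset.strongInduction with
  | _ s ih =>
  rcases s.eq_empty_or_nonempty with rfl | hs
  · simp
  -- `m` has no child in `s`, so only its own factor involves coordinate `m`, and that factor
  -- integrates to one.
  obtain ⟨m, hm, hmax⟩ := hG.wellFounded_swap.has_min (s : Set (Fin d)) hs
  have hmeas : ∀ s : Finset (Fin d), Measurable fun z => ∏ j ∈ s, ENNReal.ofReal (p j z) :=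
    fun s => Finset.measurable_prod _ fun j _ => (hp j).measurable.ennreal_ofReal
  rw [lmarginal_erase' _ (hmeas s) hm]
  rw [← ih (s.erase m) (Finset.erase_ssubset hm)]
  congr 1
  ext z
  have h1 : ∀ t, ∏ j ∈ s, ENNReal.ofReal (p j (Function.update z m t)) =
      (∏ j ∈ s.erase m, ENNReal.ofReal (p j z)) * ENNReal.ofReal (p m (Function.update z m t)) := by
    intro t
    rw [← Finset.prod_erase_mul _ _ hm]
    congr 1
    refine Finset.prod_congr rfl fun j hj => ?_
    congr 1
    refine (hp j).dependsOn fun a ha => Function.update_of_ne ?_ _ _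
    rintro rfl
    rcases ha with ha | ha
    · exact Finset.ne_of_mem_erase hj ha.symm
    · exact hmax j (Finset.mem_of_mem_erase hj) (Relation.TransGen.single ha)
  simp only [h1]
  have h2 : Measurable fun t => ENNReal.ofReal (p m (Function.update z m t)) :=
    ((hp m).measurable.comp (measurable_update z)).ennreal_ofReal
  rw [lintegral_const_mul _ h2, (hp m).lintegral_eq_one, mul_one]

/-- Integrals of functions of an ancestral set of coordinates only involve the mechanisms of
these coordinates. -/
theorem lintegral_productLaw_of_dependsOn (hG : IsDAG G) {p : Fin d → (Fin d → ℝ) → ℝ}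
    (hp : ∀ j, IsMechanism j (pa G j) (p j)) {s : Finset (Fin d)}
    (hs : ∀ j ∈ s, pa G j ⊆ s) {F : (Fin d → ℝ) → ENNReal} (hF : Measurable F)
    (hFs : DependsOn F s) (x : Fin d → ℝ) :
    ∫⁻ z, F z ∂productLaw p =
      (∫⋯∫⁻_s, fun z => (∏ j ∈ s, ENNReal.ofReal (p j z)) * F z ∂fun _ => volume) x := by
  have hmeas : ∀ s : Finset (Fin d), Measurable fun z => ∏ j ∈ s, ENNReal.ofReal (p j z) :=
    fun s => Finset.measurable_prod _ fun j _ => (hp j).measurable.ennreal_ofReal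
  have h0 : (fun z => ENNReal.ofReal (∏ j, p j z)) = fun z => ∏ j, ENNReal.ofReal (p j z) := by
    ext z
    exact ENNReal.ofReal_prod_of_nonneg fun j _ => (hp j).nonneg z
  have hdep : DependsOn (fun z => (∏ j ∈ s, ENNReal.ofReal (p j z)) * F z) (s : Set (Fin d)) := by
    intro z z' h
    simp only
    rw [hFs h]
    congr 1
    refine Finset.prod_congr rfl fun j hj => ?_
    rw [(hp j).dependsOn fun a ha => h a ?_]
    rcases ha with rfl | ha
    · exact hj
    · exact hs j hj ha
  -- The coordinates outside the ancestral set `s` are integrated first and contribute one; the base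
  -- point `x` is arbitrary.
  rw [productLaw, h0, lintegral_withDensity_eq_lintegral_mul _ (hmeas _) hF, volume_pi,
    lintegral_eq_lmarginal_univ x, ← Finset.union_compl s,
    lmarginal_union _ _ ((hmeas _).mul hF) disjoint_compl_right]
  congr 1
  ext z
  have h1 : ((fun z => ∏ j ∈ s ∪ sᶜ, ENNReal.ofReal (p j z)) * F) = fun z =>
      ((∏ j ∈ s, ENNReal.ofReal (p j z)) * F z) * ∏ j ∈ sᶜ, ENNReal.ofReal (p j z) := by
    ext z
    simp only [Pi.mul_apply, Finset.prod_union (disjoint_compl_right (a := s))]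
    ring
  rw [h1, lmarginal_mul_of_dependsOn hdep (by simp) (hmeas _), lmarginal_prod_mechanism hG hp,
    mul_one]

theorem measurable_update_uncurry (i : Fin d) :
    Measurable fun x : (Fin d → ℝ) × ℝ => Function.update x.1 i x.2 :=
  measurable_pi_iff.2 fun j => by
    by_cases hj : j = i
    · subst hj; simpa using measurable_snd
    · simpa [hj, Function.comp_def] using (measurable_pi_apply j).comp measurable_fst

/-- Resampling the coordinate `i` from its mechanism does not change integrals of functions of
`i` and its ancestors. -/
theorem lintegral_productLaw_resample (hG : IsDAG G) {p : Fin d → (Fin d → ℝ) → ℝ}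
    (hp : ∀ j, IsMechanism j (pa G j) (p j)) {i : Fin d} {F : (Fin d → ℝ) → ENNReal}
    (hF : Measurable F) (hFi : DependsOn F (ancBar G i)) :
    ∫⁻ z, F z ∂productLaw p = ∫⁻ z, (∫⁻ t : ℝ, ENNReal.ofReal (p i (Function.update z i t)) *
      F (Function.update z i t)) ∂productLaw p := by
  classical
  set s : Finset (Fin d) := (anc G i).toFinset with hsdef
  have his : i ∉ s := by simpa [hsdef] using notMem_anc_self hG i
  have hs : ∀ j ∈ s, pa G j ⊆ s := by
    intro j hj a ha
    have hj' : j ∈ anc G i := by simpa [hsdef] using hj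
    simpa [hsdef] using ancBar_subset_anc hj' (Set.mem_insert_of_mem _ (pa_subset_anc G j ha))
  have hcoe : ((insert i s : Finset (Fin d)) : Set (Fin d)) = ancBar G i := by
    simp [hsdef, ancBar]
  have hs' : ∀ j ∈ insert i s, pa G j ⊆ (insert i s : Finset (Fin d)) := by
    intro j hj
    rw [hcoe]
    rcases Finset.mem_insert.1 hj with rfl | hj
    · exact (pa_subset_anc G j).trans (Set.subset_insert _ _)
    · refine (hs j hj).trans ?_
      rw [← hcoe]
      simp
  have hpF : Measurable fun z => ENNReal.ofReal (p i z) * F z :=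
    (hp i).measurable.ennreal_ofReal.mul hF
  have hG1 : Measurable fun z => ∫⁻ t : ℝ, ENNReal.ofReal (p i (Function.update z i t)) *
      F (Function.update z i t) := (hpF.comp (measurable_update_uncurry i)).lintegral_prod_right'
  have hG2 : DependsOn (fun z => ∫⁻ t : ℝ, ENNReal.ofReal (p i (Function.update z i t)) *
      F (Function.update z i t)) (s : Set (Fin d)) := by
    intro z z' h
    refine lintegral_congr fun t => ?_
    have h2 : ∀ a ∈ ancBar G i, Function.update z i t a = Function.update z' i t a := by
      intro a ha
      rw [← hcoe] at ha
      by_cases hai : a = i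
      · subst hai; simp
      · have : a ∈ s := by simpa [hai] using ha
        simp [hai, h a this]
    rw [hFi h2, (hp i).dependsOn fun a ha =>
      h2 a (Set.insert_subset_insert (pa_subset_anc G i) ha)]
  have hmeas : ∀ s : Finset (Fin d), Measurable fun z => ∏ j ∈ s, ENNReal.ofReal (p j z) :=
    fun s => Finset.measurable_prod _ fun j _ => (hp j).measurable.ennreal_ofReal
  have hpsF : Measurable fun z => (∏ j ∈ insert i s, ENNReal.ofReal (p j z)) * F z :=
    (hmeas _).mul hF
  -- Both `s` and `insert i s` are closed under parents. The right side reduces to `s`, as its inner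
  -- integral has removed coordinate `i`; on the left, coordinate `i` is integrated innermost.
  rw [lintegral_productLaw_of_dependsOn hG hp hs hG1 hG2 0,
    lintegral_productLaw_of_dependsOn hG hp hs' hF (hcoe ▸ hFi) 0,
    lmarginal_erase' _ hpsF (Finset.mem_insert_self i s), Finset.erase_insert his]
  congr 1
  ext z
  have hpF' : Measurable fun t => ENNReal.ofReal (p i (Function.update z i t)) *
      F (Function.update z i t) := hpF.comp (measurable_update z)
  rw [← lintegral_const_mul _ hpF']
  refine lintegral_congr fun t => ?_
  simp only [Finset.prod_insert his]
  have h3 : ∏ j ∈ s, ENNReal.ofReal (p j (Function.update z i t)) =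
      ∏ j ∈ s, ENNReal.ofReal (p j z) := by
    refine Finset.prod_congr rfl fun j hj => ?_
    congr 1
    refine (hp j).dependsOn fun a ha => Function.update_of_ne ?_ _ _
    rintro rfl
    rcases ha with rfl | ha
    · exact his hj
    · exact his (hs j hj ha)
  rw [h3]
  ring

/-! ### Perfect interventions: transport of the law of a root -/

/-- The law on the line of a mechanism of the coordinate `i` that has no parents. -/
noncomputable def rootLaw (i : Fin d) (p : (Fin d → ℝ) → ℝ) : Measure ℝ :=
  volume.withDensity fun t => ENNReal.ofReal (p (Function.update 0 i t))

theorem isProbabilityMeasure_rootLaw {i : Fin d} {S : Set (Fin d)} {p : (Fin d → ℝ) → ℝ}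
    (hp : IsMechanism i S p) : IsProbabilityMeasure (rootLaw i p) :=
  ⟨by rw [rootLaw, withDensity_apply _ MeasurableSet.univ, Measure.restrict_univ,
    hp.lintegral_eq_one]⟩

/-- Without parents the resampling law is the same for all `z`: coordinate `i` is independent of its
ancestors. -/
theorem lintegral_productLaw_rootLaw (hG : IsDAG G) {p : Fin d → (Fin d → ℝ) → ℝ}
    (hp : ∀ j, IsMechanism j (pa G j) (p j)) {i : Fin d} (hpi : DependsOn (p i) {i})
    {F : (Fin d → ℝ) → ENNReal} (hF : Measurable F) (hFi : DependsOn F (ancBar G i)) :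
    ∫⁻ z, F z ∂productLaw p =
      ∫⁻ z, ∫⁻ t : ℝ, F (Function.update z i t) ∂rootLaw i (p i) ∂productLaw p := by
  rw [lintegral_productLaw_resample hG hp hF hFi]
  refine lintegral_congr fun z => ?_
  have hpm : Measurable fun t => ENNReal.ofReal (p i (Function.update 0 i t)) :=
    ((hp i).measurable.comp (measurable_update _)).ennreal_ofReal
  have hFm : Measurable fun t => F (Function.update z i t) := hF.comp (measurable_update z)
  rw [rootLaw, lintegral_withDensity_eq_lintegral_mul _ hpm hFm]
  refine lintegral_congr fun t => ?_
  simp only [Pi.mul_apply]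
  rw [hpi (y := Function.update 0 i t) (by simp)]

/-- Maps respecting the ancestors transport functions of the ancestors of `i` to such functions. -/
theorem DependsOn.comp_ancestral {β : Type*} {i : Fin d} {g : (Fin d → ℝ) → (Fin d → ℝ)}
    (hg : ∀ j, DependsOn (fun z => g z j) (ancBar G j)) {F : (Fin d → ℝ) → β}
    (hF : DependsOn F (anc G i)) : DependsOn (fun z => F (g z)) (anc G i) :=
  fun _ _ hzz' => hF fun j hj => hg j fun a ha => hzz' a (ancBar_subset_anc hj ha)

theorem DependsOn.update_eq {β : Type*} {S : Set (Fin d)} {F : (Fin d → ℝ) → β}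
    (hF : DependsOn F S) {i : Fin d} (hi : i ∉ S) (z : Fin d → ℝ) (t : ℝ) :
    F (Function.update z i t) = F z :=
  hF fun a ha => Function.update_of_ne (fun h : a = i => hi (h ▸ ha)) _ _

/-- If `h` transports `productLaw p` to `productLaw q` and respects the ancestors, and if `i` has
no parents in either law, then for almost all values of the other variables `h i` transports the
law of the coordinate `i` to the law of the coordinate `i`. -/
theorem ae_rootLaw_preimage_eq (hG : IsDAG G) {p q : Fin d → (Fin d → ℝ) → ℝ}
    (hp : ∀ j, IsMechanism j (pa G j) (p j)) (hq : ∀ j, IsMechanism j (pa G j) (q j)) {i : Fin d}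
    (hpi : DependsOn (p i) {i}) (hqi : DependsOn (q i) {i}) [IsFiniteMeasure (productLaw p)]
    {h : (Fin d → ℝ) ≃ (Fin d → ℝ)} (hm : Measurable h) (hm' : Measurable h.symm)
    (hh : ∀ j, DependsOn (fun z => h z j) (ancBar G j))
    (hh' : ∀ j, DependsOn (fun z => h.symm z j) (ancBar G j))
    (hmap : (productLaw p).map h = productLaw q) {B : Set ℝ} (hB : MeasurableSet B) :
    ∀ᵐ z ∂productLaw p,
      rootLaw i (p i) {t | h (Function.update z i t) i ∈ B} = rootLaw i (q i) B := by
  have := isProbabilityMeasure_rootLaw (hp i)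
  have := isProbabilityMeasure_rootLaw (hq i)
  set m : (Fin d → ℝ) → ENNReal :=
    fun z => rootLaw i (p i) {t | h (Function.update z i t) i ∈ B} with hmdef
  set c := rootLaw i (q i) B with hc
  have hhi : Measurable fun z => h z i := (measurable_pi_apply i).comp hm
  have hmeas : ∀ z, MeasurableSet {t | h (Function.update z i t) i ∈ B} := fun z =>
    (hhi.comp (measurable_update z)) hB
  have hm_meas : Measurable m := by
    have h1 : MeasurableSet {x : (Fin d → ℝ) × ℝ | h (Function.update x.1 i x.2) i ∈ B} :=
      (hhi.comp (measurable_update_uncurry i)) hB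
    exact measurable_measure_prodMk_left h1
  have hm_dep : DependsOn m (anc G i) := by
    intro z z' hz
    have : ∀ t, h (Function.update z i t) i = h (Function.update z' i t) i := fun t =>
      hh i fun a ha => by
        rcases ha with rfl | ha
        · simp
        · by_cases hai : a = i
          · subst hai; simp
          · simp [hai, hz a ha]
    simp only [hmdef, this]
  -- The integral of `1_B (h_i) · ψ` is computed twice: by resampling `i` in the source, and by
  -- transporting along `h` and resampling `i` in the target. In the target, `ψ ∘ h.symm` is again a
  -- function of the ancestors of `i`.
  have hψ : ∀ ψ : (Fin d → ℝ) → ENNReal, Measurable ψ → DependsOn ψ (anc G i) →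
      ∫⁻ z, m z * ψ z ∂productLaw p = c * ∫⁻ z, ψ z ∂productLaw p := by
    intro ψ hψm hψd
    have hind : Measurable (B.indicator (1 : ℝ → ENNReal)) := measurable_one.indicator hB
    have hF : Measurable fun z => B.indicator (1 : ℝ → ENNReal) (h z i) * ψ z :=
      (hind.comp hhi).mul hψm
    have e1 : ∫⁻ z, B.indicator (1 : ℝ → ENNReal) (h z i) * ψ z ∂productLaw p =
        ∫⁻ z, m z * ψ z ∂productLaw p := by
      rw [lintegral_productLaw_rootLaw hG hp hpi hF fun z z' hz => by
        have h1 : h z i = h z' i := hh i hz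
        simp only [h1, hψd fun a ha => hz a (Set.mem_insert_of_mem _ ha)]]
      refine lintegral_congr fun z => ?_
      simp only [DependsOn.update_eq hψd (notMem_anc_self hG i)]
      have h2 : Measurable fun t => B.indicator (1 : ℝ → ENNReal) (h (Function.update z i t) i) :=
        (hind.comp hhi).comp (measurable_update z)
      rw [lintegral_mul_const _ h2]
      congr 1
      exact lintegral_indicator_one (hmeas z)
    have hψm' : Measurable fun w => ψ (h.symm w) := hψm.comp hm'
    have hψd' := DependsOn.comp_ancestral hh' hψd
    have hF' : Measurable fun w : Fin d → ℝ => B.indicator (1 : ℝ → ENNReal) (w i) * ψ (h.symm w) :=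
      (hind.comp (measurable_pi_apply i)).mul hψm'
    have e2 : ∫⁻ z, B.indicator (1 : ℝ → ENNReal) (h z i) * ψ z ∂productLaw p =
        c * ∫⁻ z, ψ z ∂productLaw p := by
      have e3 : ∫⁻ z, B.indicator (1 : ℝ → ENNReal) (h z i) * ψ z ∂productLaw p =
          ∫⁻ w, B.indicator (1 : ℝ → ENNReal) (w i) * ψ (h.symm w) ∂productLaw q := by
        rw [← hmap, lintegral_map hF' hm]
        simp
      have e4 : ∫⁻ z, ψ z ∂productLaw p = ∫⁻ w, ψ (h.symm w) ∂productLaw q := by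
        rw [← hmap, lintegral_map hψm' hm]
        simp
      rw [e3, e4, lintegral_productLaw_rootLaw hG hq hqi hF' fun z z' hz => by
        simp only [hz i (Set.mem_insert _ _),
          hψd' fun a ha => hz a (Set.mem_insert_of_mem _ ha)], ← lintegral_const_mul _ hψm']
      refine lintegral_congr fun w => ?_
      simp only [DependsOn.update_eq hψd' (notMem_anc_self hG i), Function.update_self]
      rw [lintegral_mul_const _ hind, lintegral_indicator_one hB]
    rw [← e1, e2]
  have hset : ∀ C : Set (Fin d → ℝ), MeasurableSet C → DependsOn (· ∈ C) (anc G i) →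
      ∫⁻ z in C, m z ∂productLaw p = ∫⁻ _ in C, c ∂productLaw p := by
    intro C hC hCd
    have h1 := hψ (C.indicator 1) (measurable_one.indicator hC) fun z z' hz => by
      have := hCd hz
      simp only at this
      by_cases hz' : z' ∈ C
      · simp [hz', this.mpr hz']
      · have hzC : z ∉ C := fun hz => hz' (this.mp hz)
        simp [hz', hzC]
    rw [lintegral_indicator_one hC] at h1
    rw [setLIntegral_const, ← h1, ← lintegral_indicator hC]
    refine lintegral_congr fun z => ?_
    by_cases hz : z ∈ C <;> simp [hz]
  have hfin : ∀ C : Set (Fin d → ℝ), ∫⁻ _ in C, c ∂productLaw p ≠ ⊤ := by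
    intro C
    rw [setLIntegral_const]
    exact ENNReal.mul_ne_top (measure_ne_top _ _) (measure_ne_top _ _)
  -- As `m` is a function of the ancestors, `{m < c}` is an admissible test set; positive mass would
  -- make the integral of `m` over it strictly smaller than that of `c`.
  have hlt : productLaw p {z | m z < c} = 0 := by
    by_contra h0
    have hC : MeasurableSet {z | m z < c} := measurableSet_lt hm_meas measurable_const
    have e := hset _ hC fun z z' hz => by simp only [Set.mem_ofPred_eq, hm_dep hz]
    refine (setLIntegral_strict_mono hC h0 measurable_const (e ▸ hfin _)
      (Eventually.of_forall fun z hz => hz)).ne e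
  have hgt : productLaw p {z | c < m z} = 0 := by
    by_contra h0
    have hC : MeasurableSet {z | c < m z} := measurableSet_lt measurable_const hm_meas
    have e := hset _ hC fun z z' hz => by simp only [Set.mem_ofPred_eq, hm_dep hz]
    refine (setLIntegral_strict_mono hC h0 hm_meas (hfin _)
      (Eventually.of_forall fun z hz => hz)).ne e.symm
  filter_upwards [compl_mem_ae_iff.2 hlt, compl_mem_ae_iff.2 hgt] with z hz1 hz2
  exact le_antisymm (not_lt.1 hz2) (not_lt.1 hz1)

/-- `rootLaw` is the marginal of coordinate `i`, so a null open `U` would give a null open cylinder,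
against full support. -/
theorem rootLaw_pos_of_isOpen (hG : IsDAG G) {p : Fin d → (Fin d → ℝ) → ℝ}
    (hp : ∀ j, IsMechanism j (pa G j) (p j)) {i : Fin d} (hpi : DependsOn (p i) {i})
    (hsupp : (productLaw p).support = Set.univ) {U : Set ℝ} (hU : IsOpen U) (hne : U.Nonempty) :
    0 < rootLaw i (p i) U := by
  rw [pos_iff_ne_zero]
  intro h0
  have hind : Measurable (U.indicator (1 : ℝ → ENNReal)) :=
    measurable_one.indicator hU.measurableSet
  have h1 := lintegral_productLaw_rootLaw hG hp hpi
    (F := fun z => U.indicator (1 : ℝ → ENNReal) (z i)) (hind.comp (measurable_pi_apply i))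
    fun z z' hz => by simp only [hz i (Set.mem_insert _ _)]
  simp only [Function.update_self, lintegral_indicator_one hU.measurableSet, h0,
    lintegral_zero] at h1
  have hV : IsOpen ((fun z : Fin d → ℝ => z i) ⁻¹' U) := hU.preimage (continuous_apply i)
  have h2 : productLaw p ((fun z : Fin d → ℝ => z i) ⁻¹' U) = 0 := by
    rw [← lintegral_indicator_one hV.measurableSet, ← h1]
    rfl
  obtain ⟨u, hu⟩ := hne
  have h3 : (fun _ => u : Fin d → ℝ) ∈ (productLaw p).support := hsupp ▸ Set.mem_univ _
  exact ((Measure.mem_support_iff_forall _).1 h3 _ (hV.mem_nhds hu)).ne' h2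

/-! ### Rigidity of order-compatible transport, and scaling maps -/

/-- Two continuous functions on the line that induce the same order and transport a law with full
support to the same law are equal. -/
theorem eq_of_measure_le_eq {μ : Measure ℝ} [IsFiniteMeasure μ]
    (hμ : ∀ U : Set ℝ, IsOpen U → U.Nonempty → 0 < μ U) {f g : ℝ → ℝ} (hf : Continuous f)
    (hg : Continuous g) (hfg : ∀ s t, f s < f t ↔ g s < g t)
    (h : ∀ r : ℚ, μ {t | f t ≤ r} = μ {t | g t ≤ r}) : f = g := by
  have key : ∀ f g : ℝ → ℝ, Continuous f → Continuous g → (∀ s t, f s < f t ↔ g s < g t) →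
      (∀ r : ℚ, μ {t | f t ≤ r} = μ {t | g t ≤ r}) → ∀ t, g t ≤ f t := by
    intro f g hf hg hfg h t
    by_contra! hlt
    obtain ⟨r, hr1, hr2⟩ := exists_rat_btwn hlt
    -- If `g s ≤ r < g t`, the common order gives `f s < f t < r`. Thus `{f ≤ r}` contains `{g ≤ r}`
    -- and also this disjoint open set around `t`, which has positive mass.
    have hU : IsOpen {s | f s < r ∧ (r : ℝ) < g s} :=
      (isOpen_lt hf continuous_const).inter (isOpen_lt continuous_const hg)
    have hdisj : Disjoint {s | g s ≤ r} {s | f s < r ∧ (r : ℝ) < g s} :=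
      Set.disjoint_left.2 fun s hs hs' => not_lt.2 hs hs'.2
    have hsub : {s | g s ≤ r} ∪ {s | f s < r ∧ (r : ℝ) < g s} ⊆ {s | f s ≤ r} := by
      rintro s (hs | hs)
      · exact (((hfg s t).2 (lt_of_le_of_lt hs hr2)).trans hr1).le
      · exact hs.1.le
    have h1 := measure_mono (μ := μ) hsub
    rw [measure_union hdisj hU.measurableSet, h r] at h1
    have h2 := hμ _ hU ⟨t, hr1, hr2⟩
    exact absurd h1 (not_le.2 (ENNReal.lt_add_right (measure_ne_top _ _) h2.ne'))
  ext t
  exact le_antisymm (key g f hg hf (fun s t => (hfg s t).symm) (fun r => (h r).symm) t)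
    (key f g hf hg hfg h t)

/-- Under the assumptions of `ae_rootLaw_preimage_eq`, if the law has full support and `h` is a
homeomorphism, then `h i` depends only on the coordinate `i`. -/
theorem dependsOn_singleton_of_map_eq (hG : IsDAG G) {p q : Fin d → (Fin d → ℝ) → ℝ}
    (hp : ∀ j, IsMechanism j (pa G j) (p j)) (hq : ∀ j, IsMechanism j (pa G j) (q j)) {i : Fin d}
    (hpi : DependsOn (p i) {i}) (hqi : DependsOn (q i) {i}) [IsFiniteMeasure (productLaw p)]
    (hsupp : (productLaw p).support = Set.univ)
    {h : (Fin d → ℝ) ≃ (Fin d → ℝ)} (hc : Continuous h) (hc' : Continuous h.symm)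
    (hh : ∀ j, DependsOn (fun z => h z j) (ancBar G j))
    (hh' : ∀ j, DependsOn (fun z => h.symm z j) (ancBar G j))
    (hmap : (productLaw p).map h = productLaw q) :
    DependsOn (fun z => h z i) {i} := by
  have := isProbabilityMeasure_rootLaw (hp i)
  have hci : Continuous fun z => h z i := (continuous_apply i).comp hc
  have hct : ∀ t, Continuous fun z => h (Function.update z i t) i := fun t =>
    hci.comp (continuous_id.update i continuous_const)
  have hcz : ∀ z, Continuous fun t => h (Function.update z i t) i := fun z =>
    hci.comp (continuous_const.update i continuous_id)
  -- `h.symm` recovers coordinate `i` from `h_i` and the `h_a` with `a` an ancestor of `i`, and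
  -- these `h_a` do not see coordinate `i`.
  have hinj : ∀ z s t, h (Function.update z i s) i = h (Function.update z i t) i → s = t := by
    intro z s t hst
    have h1 : h.symm (h (Function.update z i s)) i = h.symm (h (Function.update z i t)) i := by
      refine hh' i fun a ha => ?_
      rcases ha with rfl | ha
      · exact hst
      · refine hh a fun b hb => ?_
        have hbi : b ≠ i := fun e => notMem_anc_self hG i (e ▸ ancBar_subset_anc ha hb)
        simp [hbi]
    simpa using h1
  -- If the order of the values at `s` and `t` changed between `z` and `z'`, the intermediate value
  -- theorem on the connected space of all `z` would give a fibre where they coincide, contradicting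
  -- injectivity.
  have hord : ∀ z z' s t, h (Function.update z i s) i < h (Function.update z i t) i →
      h (Function.update z' i s) i < h (Function.update z' i t) i := by
    intro z z' s t hz
    by_contra! hz'
    have hcst : Continuous fun z => h (Function.update z i s) i - h (Function.update z i t) i :=
      (hct s).sub (hct t)
    obtain ⟨w, hw⟩ := mem_range_of_exists_le_of_exists_ge hcst (c := 0)
      ⟨z, (sub_neg.2 hz).le⟩ ⟨z', sub_nonneg.2 hz'⟩
    have := hinj w s t (sub_eq_zero.1 hw)
    subst this
    exact lt_irrefl _ hz
  have hae : ∀ᵐ z ∂productLaw p, ∀ r : ℚ,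
      rootLaw i (p i) {t | h (Function.update z i t) i ≤ r} = rootLaw i (q i) (Set.Iic (r : ℝ)) :=
    ae_all_iff.2 fun r => by
      simpa only [Set.mem_Iic] using ae_rootLaw_preimage_eq hG hp hq hpi hqi hc.measurable
        hc'.measurable hh hh' hmap (measurableSet_Iic (a := (r : ℝ)))
  set D := {z | ∀ r : ℚ, rootLaw i (p i) {t | h (Function.update z i t) i ≤ r} =
    rootLaw i (q i) (Set.Iic (r : ℝ))} with hD
  have hdense : Dense D := by
    refine dense_iff_inter_open.2 fun U hU ⟨u, hu⟩ => ?_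
    have h3 : u ∈ (productLaw p).support := hsupp ▸ Set.mem_univ _
    have h4 := (Measure.mem_support_iff_forall _).1 h3 _ (hU.mem_nhds hu)
    by_contra hne
    have hUD : U ⊆ Dᶜ := fun x hx hxD => hne ⟨x, hx, hxD⟩
    exact h4.ne' (measure_mono_null hUD (mem_ae_iff.1 hae))
  have hDD : ∀ z ∈ D, ∀ z' ∈ D, ∀ t,
      h (Function.update z i t) i = h (Function.update z' i t) i := by
    intro z hz z' hz' t
    exact congrFun (eq_of_measure_le_eq
      (fun U hU hne => rootLaw_pos_of_isOpen hG hp hpi hsupp hU hne) (hcz z) (hcz z')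
      (fun s t => ⟨hord z z' s t, hord z' z s t⟩) fun r => (hz r).trans (hz' r).symm) t
  obtain ⟨z₀, hz₀⟩ := hdense.nonempty
  -- Equality of the fibre maps extends from the dense set `D` by continuity in `z` for fixed `t`.
  have hall : ∀ t z, h (Function.update z i t) i = h (Function.update z₀ i t) i := fun t =>
    congrFun ((hct t).ext_on hdense continuous_const fun z hz => hDD z hz z₀ hz₀ t)
  intro z z' hz
  have h1 := hall (z i) z
  have h2 := hall (z' i) z'
  rw [Function.update_eq_self] at h1 h2
  simp only
  rw [h1, h2, hz i rfl]

/-- A diffeomorphism that, like its inverse, acts on each coordinate separately is a scaling map. -/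
theorem mem_scalingMaps {h : (Fin d → ℝ) ≃ (Fin d → ℝ)} (hh : h ∈ c1Diffeos d)
    (hd : ∀ i, DependsOn (fun z => h z i) {i}) (hd' : ∀ i, DependsOn (fun z => h.symm z i) {i}) :
    (h : (Fin d → ℝ) → Fin d → ℝ) ∈ scalingMaps d := by
  refine ⟨fun i => ⟨fun t => h (Function.update 0 i t) i, fun t => h.symm (Function.update 0 i t) i,
    fun t => ?_, fun t => ?_⟩, fun i => ⟨?_, ?_⟩, ?_⟩
  · have := hd' i (x := Function.update 0 i (h (Function.update 0 i t) i))
      (y := h (Function.update 0 i t)) (by simp)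
    simpa using this
  · have := hd i (x := Function.update 0 i (h.symm (Function.update 0 i t) i))
      (y := h.symm (Function.update 0 i t)) (by simp)
    simpa using this
  · exact (contDiff_apply ℝ ℝ i).comp (hh.1.comp (contDiff_update 1 0 i))
  · exact (contDiff_apply ℝ ℝ i).comp (hh.2.comp (contDiff_update 1 0 i))
  · ext z i
    exact hd i (by simp)

end CauCA

theorem theorem1 {d K : ℕ} (G : Digraph (Fin d)) (hG : CauCA.IsDAG G)
    (τ : Fin K → Finset (Fin d)) (𝓒 : Set (CauCA.LatentCBN G τ))
    (h𝓒 : 𝓒 ⊆ CauCA.modelClass G τ (CauCA.c1Diffeos d) (CauCA.latentLaws G)) :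
    ((∀ i : Fin d, ∃ k : Fin K, τ k = {i} ∧ ∀ M ∈ 𝓒, M.InterventionalDiscrepancy k i) →
      CauCA.IsIdentifiable 𝓒 (CauCA.ancestralMaps G)) ∧
    ((∀ i : Fin d, ∃ k : Fin K, τ k = {i} ∧ ∀ M ∈ 𝓒,
        M.IsPerfect k i ∧ M.InterventionalDiscrepancy k i) →
      CauCA.IsIdentifiable 𝓒 (CauCA.scalingMaps d)) := by
  refine ⟨fun hint M hM M' hM' hmap => ?_, fun hint M hM M' hM' hmap => ?_⟩
  · refine ⟨M.mix.trans M'.mix.symm, ⟨⟨_, CauCA.c1Diffeos_trans_symm (h𝓒 hM).1 (h𝓒 hM').1, rfl⟩,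
      CauCA.dependsOn_ancBar_of_map_eq hG (h𝓒 hM) (h𝓒 hM') (fun i => ?_) hmap⟩, fun _ _ => rfl⟩
    obtain ⟨k, hk, h⟩ := hint i
    exact ⟨k, hk, h M hM, h M' hM'⟩
  -- Stated for all pairs of members because the swapped pair yields the same conclusions for the
  -- inverse of `h`.
  · have anc_dep : ∀ N ∈ 𝓒, ∀ N' ∈ 𝓒,
        (∀ k, (N.law k).map N.mix = (N'.law k).map N'.mix) → ∀ i,
        DependsOn (fun z => N.mix.trans N'.mix.symm z i) (CauCA.ancBar G i) := by
      intro N hN N' hN' hmap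
      refine CauCA.dependsOn_ancBar_of_map_eq hG (h𝓒 hN) (h𝓒 hN') (fun i => ?_) hmap
      obtain ⟨k, hk, h⟩ := hint i
      exact ⟨k, hk, (h N hN).2, (h N' hN').2⟩
    have single_dep : ∀ N ∈ 𝓒, ∀ N' ∈ 𝓒,
        (∀ k, (N.law k).map N.mix = (N'.law k).map N'.mix) → ∀ i,
        DependsOn (fun z => N.mix.trans N'.mix.symm z i) {i} := by
      intro N hN N' hN' hmap i
      obtain ⟨k, hk, h⟩ := hint i
      have hroot : ∀ N ∈ 𝓒, DependsOn (N.regimeMech (some k) i) {i} := by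
        intro N hN
        have h1 := N.isMechanism_intMech k i (by simp [hk])
        have h2 := h1.dependsOn
        rw [(h N hN).1, insert_empty_eq] at h2
        simpa [CauCA.CBN.regimeMech, hk] using h2
      obtain ⟨hprob, -, hsupp, -⟩ := (h𝓒 hN).2 (some k)
      have hc := CauCA.c1Diffeos_trans_symm (h𝓒 hN).1 (h𝓒 hN').1
      have : IsFiniteMeasure (CauCA.productLaw (N.regimeMech (some k))) :=
        inferInstanceAs (IsFiniteMeasure (N.law (some k)))
      exact CauCA.dependsOn_singleton_of_map_eq hG (N.isMechanism_regimeMech (some k))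
        (N'.isMechanism_regimeMech (some k)) (hroot N hN) (hroot N' hN') hsupp
        hc.1.continuous hc.2.continuous (anc_dep N hN N' hN' hmap)
        (anc_dep N' hN' N hN fun k => (hmap k).symm) (CauCA.map_trans_symm (hmap (some k)))
    exact ⟨_, CauCA.mem_scalingMaps (CauCA.c1Diffeos_trans_symm (h𝓒 hM).1 (h𝓒 hM').1)
      (single_dep M hM M' hM' hmap) (single_dep M' hM' M hM fun k => (hmap k).symm),
      fun _ _ => rfl⟩
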